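/- Let $K$ be a commutative field, $\theta : K \to K$ a ring homomorphism and $\delta : K \to K$ a $\theta$-derivation, that is, an additive map with $\delta(ab) = \theta(a)\delta(b) + \delta(a)b$ for all $a, b \in K$. Let $F = \{a \in K : \theta(a) = a,\ \delta(a) = 0\}$, and assume that the field extension $K/F$ is finite. Let $K[X;\theta,\delta]$ be the ring of Ore polynomials: its elements are the polynomials $\sum_i a_i X^i$ over $K$ with the usual addition, and the product is determined by $Xa = \theta(a)X + \delta(a)$ for $a \in K$. For $c \in K$ and $P = \sum_i a_i X^i$ put $\mathrm{ev}_c(P) = \sum_i a_i (\delta + c\theta)^i \in \mathrm{End}_F(K)$. The element $c$ is called ramified if $\delta + c\theta$ is of the form $a \cdot \mathrm{id}_K$ with $a \in K$, and unramified otherwise. There is a monic Ore polynomial $Z(X)$ such that the centre of $K[X;\theta,\delta]$ is $F[Z(X)]$. Let $Z(X)$ be any such polynomial and, for $c \in K$, let $\upsilon(c) \in K$ be the remainder in the right Euclidean division of $Z(X)$ by $X - c$, i.e. $Z(X) = Q \cdot (X-c) + \upsilon(c)$ with $Q \in K[X;\theta,\delta]$. Let $c_1, \ldots, c_m$ be unramified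 elements of $K$ such that the $\upsilon(c_i)$ are pairwise distinct. 1. For every nonzero $P \in K[X;\theta,\delta]$, $$\sum_{i=1}^m \dim_F \ker\big(\mathrm{ev}_{c_i}(P)\big) \leq \deg P,$$ and equality holds if and only if $P$ divides $\prod_{i=1}^m \big(Z(X) - \upsilon(c_i)\big)$. 2. For all $F$-linear subspaces $V_1, \ldots, V_m$ of $K$ there is a unique monic $P \in K[X;\theta,\delta]$ of degree $\sum_{i=1}^m \dim_F V_i$ such that $\mathrm{ev}_{c_i}(P)$ vanishes on $V_i$ for every $i$. -/

import Mathlib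

open scoped Polynomial

/-- A `θ`-derivation of a field `K`, for a ring endomorphism `θ` of `K`: an additive map `δ` with
`δ (a * b) = θ a * δ b + δ a * b`. -/
structure ThetaDerivation {K : Type*} [Field K] (θ : K →+* K) extends K →+ K where
  leibniz' : ∀ a b : K, toFun (a * b) = θ a * toFun b + toFun a * b

namespace ThetaDerivation

variable {K : Type*} [Field K] {θ : K →+* K}

instance instFunLike : FunLike (ThetaDerivation θ) K K where
  coe δ := δ.toFun
  coe_injective f g h := by
    cases f; cases g; congr; exact DFunLike.coe_injective h

theorem map_add (δ : ThetaDerivation θ) (a b : K) : δ (a + b) = δ a + δ b :=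
  δ.toAddMonoidHom.map_add a b

theorem map_zero (δ : ThetaDerivation θ) : δ 0 = 0 := δ.toAddMonoidHom.map_zero

theorem map_neg (δ : ThetaDerivation θ) (a : K) : δ (-a) = -δ a := δ.toAddMonoidHom.map_neg a

theorem leibniz (δ : ThetaDerivation θ) (a b : K) : δ (a * b) = θ a * δ b + δ a * b :=
  δ.leibniz' a b

theorem map_one (δ : ThetaDerivation θ) : δ 1 = 0 := by
  have h := δ.leibniz 1 1
  simp only [mul_one, _root_.map_one, one_mul] at h
  exact left_eq_add.mp h

/-- The subfield `F` of the elements `a` of `K` with `θ a = a` and `δ a = 0`. -/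
def constants (δ : ThetaDerivation θ) : Subfield K where
  carrier := {a | θ a = a ∧ δ a = 0}
  mul_mem' := by
    rintro a b ⟨h1, h2⟩ ⟨h3, h4⟩
    exact ⟨by rw [_root_.map_mul, h1, h3], by rw [δ.leibniz, h2, h4]; ring⟩
  one_mem' := ⟨_root_.map_one θ, δ.map_one⟩
  add_mem' := by
    rintro a b ⟨h1, h2⟩ ⟨h3, h4⟩
    exact ⟨by rw [_root_.map_add, h1, h3], by rw [δ.map_add, h2, h4, add_zero]⟩
  zero_mem' := ⟨_root_.map_zero θ, δ.map_zero⟩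
  neg_mem' := by
    rintro a ⟨h1, h2⟩
    exact ⟨by rw [_root_.map_neg, h1], by rw [δ.map_neg, h2, neg_zero]⟩
  inv_mem' := by
    rintro a ⟨h1, h2⟩
    refine ⟨by rw [map_inv₀, h1], ?_⟩
    by_cases ha : a = 0
    · simp [ha, δ.map_zero]
    · have h := δ.leibniz a a⁻¹
      rw [mul_inv_cancel₀ ha, δ.map_one, h1, h2, zero_mul, add_zero] at h
      exact (mul_eq_zero.mp h.symm).resolve_left ha

theorem mem_constants (δ : ThetaDerivation θ) {a : K} :
    a ∈ δ.constants ↔ θ a = a ∧ δ a = 0 := Iff.rfl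

end ThetaDerivation

/-- The Ore polynomials `K[X; θ, δ]`: an element is a polynomial `∑ aᵢ Xⁱ` with coefficients in `K`
written on the left. The product, defined below, is not that of `K[X]`. -/
@[ext]
structure OrePoly {K : Type*} [Field K] (θ : K →+* K) (δ : ThetaDerivation θ) where
  ofPoly ::
  toPoly : K[X]

namespace OrePoly

variable {K : Type*} [Field K] {θ : K →+* K} {δ : ThetaDerivation θ}

theorem end_mul_apply (f g : AddMonoid.End K[X]) (P : K[X]) : (f * g) P = f (g P) := rfl

theorem end_add_apply (f g : AddMonoid.End K[X]) (P : K[X]) : (f + g) P = f P + g P := rfl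

theorem mulLeft_apply (P Q : K[X]) : AddMonoid.End.mulLeft P Q = P * Q := rfl

/-- Left multiplication by `X`, i.e. the additive map
`b Xⁱ ↦ (X b) Xⁱ = θ b Xⁱ⁺¹ + δ b Xⁱ`. -/
noncomputable def xMul (θ : K →+* K) (δ : ThetaDerivation θ) : AddMonoid.End K[X] where
  toFun Q := Q.sum fun i b => Polynomial.monomial (i + 1) (θ b) + Polynomial.monomial i (δ b)
  map_zero' := by simp
  map_add' P Q := by
    apply Polynomial.sum_add_index
    · intro i; simp [δ.map_zero]
    · intro i a b; simp only [map_add, δ.map_add]; abel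

/-- The product of Ore polynomials: `(∑ aᵢ Xⁱ) * Q = ∑ aᵢ (Xⁱ Q)`. -/
noncomputable def mulHom (θ : K →+* K) (δ : ThetaDerivation θ) :
    K[X] →+ AddMonoid.End K[X] where
  toFun P := P.sum fun i a => AddMonoid.End.mulLeft (Polynomial.C a) * xMul θ δ ^ i
  map_zero' := by simp
  map_add' P Q := by
    apply Polynomial.sum_add_index
    · intro i; simp
    · intro i a b; simp [add_mul]

theorem xMul_monomial (i : ℕ) (b : K) : xMul θ δ (Polynomial.monomial i b) =
    Polynomial.monomial (i + 1) (θ b) + Polynomial.monomial i (δ b) := by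
  exact Polynomial.sum_monomial_index b
    (fun i b => Polynomial.monomial (i + 1) (θ b) + Polynomial.monomial i (δ b))
    (by simp [δ.map_zero])

theorem mulHom_monomial (i : ℕ) (a : K) : mulHom θ δ (Polynomial.monomial i a) =
    AddMonoid.End.mulLeft (Polynomial.C a) * xMul θ δ ^ i := by
  exact Polynomial.sum_monomial_index a
    (fun i a => AddMonoid.End.mulLeft (Polynomial.C a) * xMul θ δ ^ i) (by simp)

theorem xMul_C_mul (b : K) (Q : K[X]) : xMul θ δ (Polynomial.C b * Q) =
    Polynomial.C (θ b) * xMul θ δ Q + Polynomial.C (δ b) * Q := by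
  induction Q using Polynomial.induction_on' with
  | add p q hp hq => simp only [mul_add, map_add, hp, hq]; abel
  | monomial n a =>
    simp only [Polynomial.C_mul_monomial, xMul_monomial, mul_add, δ.leibniz, map_add, map_mul]
    abel

theorem mulHom_C_mul (δ : ThetaDerivation θ) (a : K) (Q : K[X]) : mulHom θ δ (Polynomial.C a * Q) =
    AddMonoid.End.mulLeft (Polynomial.C a) * mulHom θ δ Q := by
  induction Q using Polynomial.induction_on' with
  | add p q hp hq => rw [mul_add, map_add, map_add, mul_add, hp, hq]
  | monomial n b =>
    rw [Polynomial.C_mul_monomial, mulHom_monomial, mulHom_monomial]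
    ext1 R
    simp only [end_mul_apply, mulLeft_apply, map_mul, mul_assoc]

theorem mulHom_xMul (Q : K[X]) : mulHom θ δ (xMul θ δ Q) = xMul θ δ * mulHom θ δ Q := by
  induction Q using Polynomial.induction_on' with
  | add p q hp hq => rw [map_add, map_add, map_add, mul_add, hp, hq]
  | monomial n b =>
    rw [xMul_monomial, map_add, mulHom_monomial, mulHom_monomial, mulHom_monomial]
    ext1 R
    simp only [end_mul_apply, end_add_apply, pow_succ']
    exact (xMul_C_mul b _).symm

theorem mulHom_mulHom (P Q : K[X]) :
    mulHom θ δ (mulHom θ δ P Q) = mulHom θ δ P * mulHom θ δ Q := by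
  have hpow : ∀ i : ℕ, mulHom θ δ ((xMul θ δ ^ i) Q) = xMul θ δ ^ i * mulHom θ δ Q := by
    intro i
    induction i with
    | zero => simp
    | succ i ih =>
      rw [pow_succ', end_mul_apply, mulHom_xMul, ih, mul_assoc]
  induction P using Polynomial.induction_on' with
  | add p q hp hq => simp only [add_mul, map_add, end_add_apply, hp, hq]
  | monomial n a =>
    rw [mulHom_monomial, end_mul_apply, mul_assoc, ← hpow, ← mulHom_C_mul δ]
    rfl

theorem mulHom_one_left (Q : K[X]) : mulHom θ δ 1 Q = Q := by
  rw [← Polynomial.monomial_zero_one, mulHom_monomial]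
  simp [mulLeft_apply]

theorem mulHom_one_right (P : K[X]) : mulHom θ δ P 1 = P := by
  have hpow : ∀ i : ℕ, (xMul θ δ ^ i) 1 = Polynomial.monomial i 1 := by
    intro i
    induction i with
    | zero => simp
    | succ i ih =>
      rw [pow_succ', end_mul_apply, ih, xMul_monomial, δ.map_one]
      simp
  induction P using Polynomial.induction_on' with
  | add p q hp hq => simp only [map_add, end_add_apply, hp, hq]
  | monomial n a =>
    rw [mulHom_monomial, end_mul_apply, hpow]
    simp [mulLeft_apply, Polynomial.C_mul_monomial]

noncomputable instance instZero : Zero (OrePoly θ δ) := ⟨⟨0⟩⟩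
noncomputable instance instOne : One (OrePoly θ δ) := ⟨⟨1⟩⟩
noncomputable instance instAdd : Add (OrePoly θ δ) := ⟨fun P Q => ⟨P.toPoly + Q.toPoly⟩⟩
noncomputable instance instNeg : Neg (OrePoly θ δ) := ⟨fun P => ⟨-P.toPoly⟩⟩
noncomputable instance instMul : Mul (OrePoly θ δ) :=
  ⟨fun P Q => ⟨mulHom θ δ P.toPoly Q.toPoly⟩⟩

@[simp] theorem toPoly_zero : (0 : OrePoly θ δ).toPoly = 0 := rfl
@[simp] theorem toPoly_one : (1 : OrePoly θ δ).toPoly = 1 := rfl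
@[simp] theorem toPoly_add (P Q : OrePoly θ δ) : (P + Q).toPoly = P.toPoly + Q.toPoly := rfl
@[simp] theorem toPoly_neg (P : OrePoly θ δ) : (-P).toPoly = -P.toPoly := rfl
theorem toPoly_mul (P Q : OrePoly θ δ) : (P * Q).toPoly = mulHom θ δ P.toPoly Q.toPoly := rfl

noncomputable instance instRing : Ring (OrePoly θ δ) where
  add_assoc P Q R := by ext1; simp [add_assoc]
  zero_add P := by ext1; simp
  add_zero P := by ext1; simp
  add_comm P Q := by ext1; simp [add_comm]
  neg_add_cancel P := by ext1; simp
  nsmul := nsmulRec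
  zsmul := zsmulRec
  left_distrib P Q R := by ext1; simp [toPoly_mul]
  right_distrib P Q R := by ext1; simp [toPoly_mul, end_add_apply]
  zero_mul P := by ext1; simp [toPoly_mul]
  mul_zero P := by ext1; simp [toPoly_mul]
  mul_assoc P Q R := by ext1; simp [toPoly_mul, mulHom_mulHom]
  one_mul P := by ext1; simp [toPoly_mul, mulHom_one_left]
  mul_one P := by ext1; simp [toPoly_mul, mulHom_one_right]

/-- The constant Ore polynomials. -/
noncomputable def C : K →+* OrePoly θ δ where
  toFun a := ⟨Polynomial.C a⟩
  map_zero' := by ext1; simp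
  map_one' := by ext1; simp
  map_add' a b := by ext1; simp
  map_mul' a b := by
    ext1
    rw [toPoly_mul]
    change _ = mulHom θ δ (Polynomial.C a) (Polynomial.C b)
    rw [← Polynomial.monomial_zero_left (a := a), mulHom_monomial]
    simp [mulLeft_apply]

/-- The variable `X`. -/
noncomputable def X : OrePoly θ δ := ⟨Polynomial.X⟩

theorem toPoly_C_mul (a : K) (P : OrePoly θ δ) :
    (C a * P).toPoly = Polynomial.C a * P.toPoly := by
  rw [toPoly_mul]
  change mulHom θ δ (Polynomial.C a) _ = _
  rw [← Polynomial.monomial_zero_left, mulHom_monomial]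
  simp [mulLeft_apply]

theorem toPoly_X_mul (P : OrePoly θ δ) : (X * P).toPoly = xMul θ δ P.toPoly := by
  rw [toPoly_mul]
  change mulHom θ δ Polynomial.X _ = _
  rw [← Polynomial.monomial_one_one_eq_X, mulHom_monomial]
  simp [mulLeft_apply]

/-- The defining commutation rule `X a = θ a X + δ a`. -/
theorem X_mul_C (a : K) : (X * C a : OrePoly θ δ) = C (θ a) * X + C (δ a) := by
  ext1
  rw [toPoly_X_mul, toPoly_add, toPoly_C_mul]
  change xMul θ δ (Polynomial.C a) = Polynomial.C (θ a) * Polynomial.X + Polynomial.C (δ a)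
  rw [← Polynomial.monomial_zero_left, xMul_monomial, Polynomial.C_mul_X_eq_monomial,
    Polynomial.monomial_zero_left]

/-- Induction on Ore polynomials: constants, sums and left multiplication by `X`
and by constants generate everything. -/
theorem induction_X {p : OrePoly θ δ → Prop} (hC : ∀ a, p (C a))
    (hadd : ∀ P Q, p P → p Q → p (P + Q)) (hCmul : ∀ a P, p P → p (C a * P))
    (hX : ∀ P, p P → p (X * P)) (P : OrePoly θ δ) : p P := by
  have hpow : ∀ n : ℕ, p ⟨Polynomial.monomial n 1⟩ := by
    intro n
    induction n with
    | zero => exact hC 1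
    | succ n ih =>
      have h := hX _ ih
      have e : (X * ⟨Polynomial.monomial n 1⟩ : OrePoly θ δ) = ⟨Polynomial.monomial (n + 1) 1⟩ := by
        ext1
        rw [toPoly_X_mul, xMul_monomial, δ.map_one]
        simp
      rwa [e] at h
  obtain ⟨P⟩ := P
  induction P using Polynomial.induction_on' with
  | add P Q hP hQ => exact hadd _ _ hP hQ
  | monomial n a =>
    have h := hCmul a _ (hpow n)
    have e : (C a * ⟨Polynomial.monomial n 1⟩ : OrePoly θ δ) = ⟨Polynomial.monomial n a⟩ := by
      ext1
      rw [toPoly_C_mul, Polynomial.C_mul_monomial, mul_one]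
    rwa [e] at h

theorem C_mul_comm {a : K} (ha : a ∈ δ.constants) (P : OrePoly θ δ) : C a * P = P * C a := by
  induction P using induction_X with
  | hC b => rw [← map_mul, ← map_mul, mul_comm]
  | hadd P Q hP hQ => rw [mul_add, add_mul, hP, hQ]
  | hCmul b P hP => rw [mul_assoc, ← hP, ← mul_assoc, ← mul_assoc, ← map_mul, ← map_mul, mul_comm]
  | hX P hP =>
    have h : (X * C a : OrePoly θ δ) = C a * X := by
      rw [X_mul_C, ha.1, ha.2, map_zero, add_zero]
    rw [mul_assoc, ← hP, ← mul_assoc, ← mul_assoc, h]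

/-- `K[X; θ, δ]` as an algebra over the subfield `F` of constants. -/
noncomputable instance instAlgebra : Algebra δ.constants (OrePoly θ δ) where
  algebraMap := C.comp δ.constants.subtype
  smul a P := C (a : K) * P
  commutes' a P := C_mul_comm a.2 P
  smul_def' _ _ := rfl

/-- The degree of an Ore polynomial (`0` for the zero polynomial). -/
noncomputable def natDegree (P : OrePoly θ δ) : ℕ := P.toPoly.natDegree

/-- An Ore polynomial is monic if its leading coefficient is `1`. -/
def Monic (P : OrePoly θ δ) : Prop := P.toPoly.Monic

/-- `Z` is a monic Ore polynomial such that the centre of `K[X; θ, δ]` is `F[Z]`. -/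
def IsCentreGenerator (Z : OrePoly θ δ) : Prop :=
  Z.Monic ∧ Subalgebra.center δ.constants (OrePoly θ δ) = Algebra.adjoin δ.constants {Z}

/-- The pseudo-linear endomorphism `δ + c θ` of `K`, an `F`-linear map. -/
def pseudoLinear (δ : ThetaDerivation θ) (c : K) : K →ₗ[δ.constants] K where
  toFun x := δ x + c * θ x
  map_add' x y := by rw [δ.map_add, map_add]; ring
  map_smul' a x := by
    simp only [Subfield.smul_def, smul_eq_mul, RingHom.id_apply, δ.leibniz, map_mul]
    rw [a.2.1, a.2.2]; ring

/-- `c` is ramified if `δ + c θ` is a scalar multiple of the identity of `K`. -/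
def IsRamified (δ : ThetaDerivation θ) (c : K) : Prop :=
  ∃ a : K, pseudoLinear δ c = a • LinearMap.id

/-- The evaluation `ev_c (∑ aᵢ Xⁱ) = ∑ aᵢ (δ + c θ)ⁱ`, an `F`-linear endomorphism of `K`. -/
noncomputable def ev (c : K) (P : OrePoly θ δ) : Module.End δ.constants K :=
  P.toPoly.sum fun i a => a • pseudoLinear δ c ^ i

/-- Right Euclidean division by `X - c`. -/
theorem exists_remainder (c : K) (P : OrePoly θ δ) :
    ∃ (r : K) (Q : OrePoly θ δ), P = Q * (X - C c) + C r := by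
  induction P using induction_X with
  | hC a => exact ⟨a, 0, by simp⟩
  | hadd P P' hP hP' =>
    obtain ⟨r, Q, rfl⟩ := hP
    obtain ⟨r', Q', rfl⟩ := hP'
    exact ⟨r + r', Q + Q', by rw [map_add, add_mul]; abel⟩
  | hCmul a P hP =>
    obtain ⟨r, Q, rfl⟩ := hP
    exact ⟨a * r, C a * Q, by rw [map_mul, mul_add, mul_assoc]⟩
  | hX P hP =>
    obtain ⟨r, Q, rfl⟩ := hP
    refine ⟨θ r * c + δ r, X * Q + C (θ r), ?_⟩
    rw [mul_add, X_mul_C, map_add, map_mul]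
    noncomm_ring

/-- The remainder, a constant, of the right Euclidean division of `P` by `X - c`. -/
noncomputable def remainder (P : OrePoly θ δ) (c : K) : K :=
  (exists_remainder c P).choose

theorem remainder_spec (P : OrePoly θ δ) (c : K) :
    ∃ Q : OrePoly θ δ, P = Q * (X - C c) + C (P.remainder c) :=
  (exists_remainder c P).choose_spec

/-- `υ(c)`, relative to the chosen generator `Z` of the centre: the remainder of the right
Euclidean division of `Z` by `X - c`. -/
noncomputable def upsilon (Z : OrePoly θ δ) (c : K) : K := Z.remainder c

theorem ev_add (c : K) (P Q : OrePoly θ δ) : ev c (P + Q) = ev c P + ev c Q := by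
  apply Polynomial.sum_add_index
  · intro i; simp
  · intro i a b; rw [add_smul]

theorem ev_C (c a : K) : ev c (C a : OrePoly θ δ) = a • (1 : Module.End δ.constants K) := by
  change Polynomial.sum (Polynomial.C a) _ = _
  rw [Polynomial.sum_C_index] <;> simp

theorem ev_monomial (c : K) (n : ℕ) (a : K) :
    ev c (⟨Polynomial.monomial n a⟩ : OrePoly θ δ) = a • pseudoLinear δ c ^ n := by
  change Polynomial.sum (Polynomial.monomial n a) _ = _
  rw [Polynomial.sum_monomial_index]; simp

theorem ev_C_mul (c a : K) (P : OrePoly θ δ) : ev c (C a * P) = a • ev c P := by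
  obtain ⟨P⟩ := P
  induction P using Polynomial.induction_on' with
  | add P Q hP hQ =>
    change ev c (C a * (⟨P⟩ + ⟨Q⟩)) = a • ev c (⟨P⟩ + ⟨Q⟩)
    rw [mul_add, ev_add, ev_add, hP, hQ, smul_add]
  | monomial n b =>
    have e : (C a * ⟨Polynomial.monomial n b⟩ : OrePoly θ δ) = ⟨Polynomial.monomial n (a * b)⟩ := by
      ext1
      rw [toPoly_C_mul, Polynomial.C_mul_monomial]
    rw [e, ev_monomial, ev_monomial, mul_smul]

theorem ev_X_mul (c : K) (P : OrePoly θ δ) : ev c (X * P) = pseudoLinear δ c * ev c P := by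
  obtain ⟨P⟩ := P
  induction P using Polynomial.induction_on' with
  | add P Q hP hQ =>
    change ev c (X * (⟨P⟩ + ⟨Q⟩)) = _ * ev c (⟨P⟩ + ⟨Q⟩)
    rw [mul_add, ev_add, ev_add, hP, hQ, mul_add]
  | monomial n b =>
    have e : (X * ⟨Polynomial.monomial n b⟩ : OrePoly θ δ) =
        ⟨Polynomial.monomial (n + 1) (θ b)⟩ + ⟨Polynomial.monomial n (δ b)⟩ := by
      ext1
      rw [toPoly_X_mul, xMul_monomial]; rfl
    rw [e, ev_add, ev_monomial, ev_monomial, ev_monomial, pow_succ']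
    ext x
    simp only [LinearMap.add_apply, LinearMap.smul_apply, Module.End.mul_apply, smul_eq_mul]
    simp only [pseudoLinear, LinearMap.coe_mk, AddHom.coe_mk, δ.leibniz, map_mul]
    ring

/-- `ev_c` is multiplicative. -/
theorem ev_mul (c : K) (P Q : OrePoly θ δ) : ev c (P * Q) = ev c P * ev c Q := by
  induction P using induction_X with
  | hC a => rw [ev_C_mul, ev_C, smul_mul_assoc, one_mul]
  | hadd P P' hP hP' => rw [add_mul, ev_add, ev_add, hP, hP', add_mul]
  | hCmul a P hP => rw [mul_assoc, ev_C_mul, ev_C_mul, hP, smul_mul_assoc]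
  | hX P hP => rw [mul_assoc, ev_X_mul, ev_X_mul, hP, mul_assoc]

/-- The remainder of the right division by `X - c` is unique. -/
theorem remainder_unique {P Q : OrePoly θ δ} {c r : K} (h : P = Q * (X - C c) + C r) :
    P.remainder c = r := by
  have key : ∀ (Q : OrePoly θ δ) (r : K), ev c (Q * (X - C c) + C r) 1 = r := by
    intro Q r
    have h1 : ev c (X - C c : OrePoly θ δ) 1 = 0 := by
      have h2 : (X - C c : OrePoly θ δ) = X * C 1 + C (-c) := by
        rw [map_one, mul_one, map_neg, sub_eq_add_neg]
      rw [h2, ev_add, ev_X_mul, ev_C, ev_C]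
      simp [pseudoLinear, δ.map_one]
    rw [ev_add, ev_mul, ev_C]
    simp [h1]
  obtain ⟨Q', h'⟩ := P.remainder_spec c
  rw [← key Q' (P.remainder c), ← h', h, key]

end OrePoly

/-! Write F for the constants and r = [K : F]. Through `ev c`, K is a simple module over the Ore
polynomials. If c is unramified its endomorphisms are the scalars in F, so Jacobson density makes
`ev c` surjective onto End_F(K) (`ev_surjective`). A central Z acts at c as the scalar υ(c), which
lies in F. When the υ(c_i) are distinct, Lagrange polynomials in Z separate the points, and the
evaluations at the c_i can be prescribed independently (`exists_forall_ev_eq`).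

Hence P ↦ (ev_{c_i}(P) restricted to V_i) maps onto the product of the Hom_F(V_i, K), of K-dimension
∑ dim V_i. Its kernel is a left ideal, hence generated by a monic G whose degree is that codimension
(`exists_annihilator`). This is part 2. For part 1 take V_i = ker ev_{c_i}(P): then P = S G, which
is the inequality, and equality means that S is a constant.

Let M be the product of the Z − υ(c_i), which every evaluation kills. If P is associate to G, then P
divides M on the right, hence on the left because M is central. The converse needs M to generate the
common kernel of the evaluations, that is, deg Z = r. This comes from an explicit monic central
element of degree r (`exists_central`), which also generates the centre. -/

namespace OrePoly

variable {K : Type*} [Field K] {θ : K →+* K} {δ : ThetaDerivation θ}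

/-! ### Degrees, leading coefficients and right division -/

@[simp] theorem toPoly_sub (P Q : OrePoly θ δ) : (P - Q).toPoly = P.toPoly - Q.toPoly := by
  rw [sub_eq_add_neg, toPoly_add, toPoly_neg, sub_eq_add_neg]

theorem toPoly_C (a : K) : (C a : OrePoly θ δ).toPoly = Polynomial.C a := rfl

theorem toPoly_eq_zero {P : OrePoly θ δ} : P.toPoly = 0 ↔ P = 0 :=
  ⟨fun h => OrePoly.ext h, fun h => by rw [h, toPoly_zero]⟩

theorem coeff_xMul_zero (Q : K[X]) : (xMul θ δ Q).coeff 0 = δ (Q.coeff 0) := by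
  induction Q using Polynomial.induction_on' with
  | add p q hp hq => rw [map_add, Polynomial.coeff_add, hp, hq, Polynomial.coeff_add, δ.map_add]
  | monomial n a =>
    rw [xMul_monomial]
    simp only [Polynomial.coeff_add, Polynomial.coeff_monomial]
    split_ifs <;> simp_all [δ.map_zero]

theorem coeff_xMul_succ (Q : K[X]) (k : ℕ) :
    (xMul θ δ Q).coeff (k + 1) = θ (Q.coeff k) + δ (Q.coeff (k + 1)) := by
  induction Q using Polynomial.induction_on' with
  | add p q hp hq =>
    simp only [map_add, Polynomial.coeff_add, hp, hq, δ.map_add]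
    abel
  | monomial n a =>
    rw [xMul_monomial]
    simp only [Polynomial.coeff_add, Polynomial.coeff_monomial, Nat.add_right_cancel_iff]
    split_ifs <;> simp [δ.map_zero]

theorem natDegree_xMul_le {Q : K[X]} {d : ℕ} (h : Q.natDegree ≤ d) :
    (xMul θ δ Q).natDegree ≤ d + 1 := by
  rw [Polynomial.natDegree_le_iff_coeff_eq_zero]
  intro N hN
  obtain ⟨k, rfl⟩ : ∃ k, N = k + 1 := ⟨N - 1, by omega⟩
  rw [coeff_xMul_succ, Polynomial.coeff_eq_zero_of_natDegree_lt (by omega),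
    Polynomial.coeff_eq_zero_of_natDegree_lt (by omega), map_zero, δ.map_zero, add_zero]

theorem natDegree_xMul_pow_le {Q : K[X]} {d : ℕ} (h : Q.natDegree ≤ d) (n : ℕ) :
    ((xMul θ δ ^ n) Q).natDegree ≤ n + d := by
  induction n with
  | zero => simpa using h
  | succ n ih =>
    rw [pow_succ', end_mul_apply]
    exact (natDegree_xMul_le ih).trans (by omega)

theorem coeff_xMul_pow {Q : K[X]} {d : ℕ} (h : Q.natDegree ≤ d) (n : ℕ) :
    ((xMul θ δ ^ n) Q).coeff (n + d) = (θ ^ n) (Q.coeff d) := by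
  induction n with
  | zero => simp
  | succ n ih =>
    rw [pow_succ', end_mul_apply, Nat.add_right_comm, coeff_xMul_succ, ih,
      Polynomial.coeff_eq_zero_of_natDegree_lt
        ((natDegree_xMul_pow_le h n).trans_lt (Nat.lt_succ_self _)), δ.map_zero, add_zero,
      pow_succ', RingHom.mul_def, RingHom.comp_apply]

theorem natDegree_mulHom_le {P Q : K[X]} {n d : ℕ} (hP : P.natDegree ≤ n) (hQ : Q.natDegree ≤ d) :
    (mulHom θ δ P Q).natDegree ≤ n + d := by
  refine Polynomial.induction_with_natDegree_le
    (fun P => (mulHom θ δ P Q).natDegree ≤ n + d) n ?zero ?mon ?add P hP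
  case zero => simp
  case mon =>
    intro k r hr hk
    rw [Polynomial.C_mul_X_pow_eq_monomial, mulHom_monomial, end_mul_apply, mulLeft_apply]
    exact (Polynomial.natDegree_C_mul_le _ _).trans
      ((natDegree_xMul_pow_le hQ k).trans (by omega))
  case add =>
    intro f g hfg hg hf' hg'
    rw [map_add, end_add_apply]
    exact Polynomial.natDegree_add_le_of_degree_le hf' hg'

/-- Moving X ^ n past a coefficient b gives θ ^ n (b) X ^ n plus lower terms, so only the top
coefficients meet in degree n + d, the second one twisted by θ ^ n. -/
theorem coeff_mulHom {P Q : K[X]} {n d : ℕ} (hP : P.natDegree ≤ n) (hQ : Q.natDegree ≤ d) :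
    (mulHom θ δ P Q).coeff (n + d) = P.coeff n * (θ ^ n) (Q.coeff d) := by
  refine Polynomial.induction_with_natDegree_le
    (fun P => (mulHom θ δ P Q).coeff (n + d) = P.coeff n * (θ ^ n) (Q.coeff d)) n ?zero ?mon ?add P hP
  case zero => simp
  case mon =>
    intro k r hr hk
    rw [Polynomial.C_mul_X_pow_eq_monomial, mulHom_monomial, end_mul_apply, mulLeft_apply,
      Polynomial.coeff_C_mul, Polynomial.coeff_monomial]
    rcases hk.eq_or_lt with rfl | hlt
    · rw [coeff_xMul_pow hQ, if_pos rfl]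
    · rw [if_neg hlt.ne, Polynomial.coeff_eq_zero_of_natDegree_lt
        ((natDegree_xMul_pow_le hQ k).trans_lt (by omega)), mul_zero, zero_mul]
  case add =>
    intro f g hfg hg hf' hg'
    rw [map_add, end_add_apply, Polynomial.coeff_add, hf', hg',
      Polynomial.coeff_add, add_mul]

theorem coeff_mul_natDegree_add (P Q : OrePoly θ δ) :
    (P * Q).toPoly.coeff (P.natDegree + Q.natDegree) =
      P.toPoly.leadingCoeff * (θ ^ P.natDegree) Q.toPoly.leadingCoeff :=
  coeff_mulHom le_rfl le_rfl

/-- θ is injective, as K is a field, so the twist by a power of θ cannot kill a leading coefficient.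
Hence degrees add and the ring is a domain. -/
theorem coeff_mul_natDegree_add_ne_zero {P Q : OrePoly θ δ} (hP : P ≠ 0) (hQ : Q ≠ 0) :
    (P * Q).toPoly.coeff (P.natDegree + Q.natDegree) ≠ 0 := by
  rw [coeff_mul_natDegree_add]
  refine mul_ne_zero ?_ ((map_ne_zero _).mpr ?_)
  · rwa [Ne, Polynomial.leadingCoeff_eq_zero, toPoly_eq_zero]
  · rwa [Ne, Polynomial.leadingCoeff_eq_zero, toPoly_eq_zero]

theorem natDegree_mul {P Q : OrePoly θ δ} (hP : P ≠ 0) (hQ : Q ≠ 0) :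
    (P * Q).natDegree = P.natDegree + Q.natDegree :=
  le_antisymm (natDegree_mulHom_le le_rfl le_rfl)
    (Polynomial.le_natDegree_of_ne_zero (coeff_mul_natDegree_add_ne_zero hP hQ))

theorem leadingCoeff_mul {P Q : OrePoly θ δ} (hP : P ≠ 0) (hQ : Q ≠ 0) :
    (P * Q).toPoly.leadingCoeff =
      P.toPoly.leadingCoeff * (θ ^ P.natDegree) Q.toPoly.leadingCoeff := by
  rw [← coeff_mul_natDegree_add, ← natDegree_mul hP hQ]
  rfl

instance instNontrivial : Nontrivial (OrePoly θ δ) :=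
  ⟨0, 1, fun h => zero_ne_one (α := K[X]) (congrArg toPoly h)⟩

instance instNoZeroDivisors : NoZeroDivisors (OrePoly θ δ) where
  eq_zero_or_eq_zero_of_mul_eq_zero {P Q} h := by
    by_contra! hPQ
    exact coeff_mul_natDegree_add_ne_zero hPQ.1 hPQ.2 (by rw [h]; simp)

instance instIsDomain : IsDomain (OrePoly θ δ) := NoZeroDivisors.to_isDomain _

theorem Monic.ne_zero {P : OrePoly θ δ} (hP : P.Monic) : P ≠ 0 := fun h =>
  Polynomial.Monic.ne_zero hP (toPoly_eq_zero.mpr h)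

theorem Monic.mul {P Q : OrePoly θ δ} (hP : P.Monic) (hQ : Q.Monic) : (P * Q).Monic := by
  have h := leadingCoeff_mul hP.ne_zero hQ.ne_zero
  rwa [Polynomial.Monic.leadingCoeff hP, Polynomial.Monic.leadingCoeff hQ, map_one, mul_one] at h

theorem monic_one : (1 : OrePoly θ δ).Monic := Polynomial.monic_one

theorem monic_X : (X : OrePoly θ δ).Monic := Polynomial.monic_X

theorem natDegree_one : (1 : OrePoly θ δ).natDegree = 0 := Polynomial.natDegree_one

theorem natDegree_X : (X : OrePoly θ δ).natDegree = 1 := Polynomial.natDegree_X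

theorem natDegree_C (a : K) : (C a : OrePoly θ δ).natDegree = 0 := Polynomial.natDegree_C a

theorem Monic.pow {P : OrePoly θ δ} (hP : P.Monic) (n : ℕ) : (P ^ n).Monic := by
  induction n with
  | zero => rw [pow_zero]; exact monic_one
  | succ n ih => rw [pow_succ]; exact ih.mul hP

theorem natDegree_pow {P : OrePoly θ δ} (hP : P ≠ 0) (n : ℕ) :
    (P ^ n).natDegree = n * P.natDegree := by
  induction n with
  | zero => rw [pow_zero, zero_mul, natDegree_one]
  | succ n ih => rw [pow_succ, natDegree_mul (pow_ne_zero n hP) hP, ih, add_mul, one_mul]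

theorem Monic.add_C {P : OrePoly θ δ} (hP : P.Monic) (h0 : 0 < P.natDegree) (a : K) :
    (P + C a).Monic :=
  Polynomial.Monic.add_of_left hP (Polynomial.degree_C_le.trans_lt
    (Polynomial.natDegree_pos_iff_degree_pos.mp h0))

theorem natDegree_add_C (P : OrePoly θ δ) (a : K) : (P + C a).natDegree = P.natDegree :=
  Polynomial.natDegree_add_C

theorem Monic.sub_C {P : OrePoly θ δ} (hP : P.Monic) (h0 : 0 < P.natDegree) (a : K) :
    (P - C a).Monic := by
  rw [sub_eq_add_neg, ← map_neg]
  exact hP.add_C h0 _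

theorem natDegree_sub_C (P : OrePoly θ δ) (a : K) : (P - C a).natDegree = P.natDegree :=
  Polynomial.natDegree_sub_C

theorem eq_C_of_natDegree_eq_zero {P : OrePoly θ δ} (h : P.natDegree = 0) :
    P = C (P.toPoly.coeff 0) :=
  OrePoly.ext (Polynomial.eq_C_of_natDegree_eq_zero h)

theorem Monic.eq_one_of_natDegree_eq_zero {P : OrePoly θ δ} (hP : P.Monic)
    (h : P.natDegree = 0) : P = 1 :=
  OrePoly.ext (Polynomial.eq_one_of_monic_natDegree_zero hP h)

theorem toPoly_mul_X (P : OrePoly θ δ) : (P * X).toPoly = P.toPoly * Polynomial.X := by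
  have hpow : ∀ i : ℕ, (xMul θ δ ^ i) Polynomial.X = Polynomial.monomial (i + 1) 1 := by
    intro i
    induction i with
    | zero => simp [Polynomial.monomial_one_one_eq_X]
    | succ i ih =>
      rw [pow_succ', end_mul_apply, ih, xMul_monomial, δ.map_one]
      simp
  obtain ⟨P⟩ := P
  change mulHom θ δ P Polynomial.X = P * Polynomial.X
  induction P using Polynomial.induction_on' with
  | add p q hp hq => simp only [map_add, end_add_apply, hp, hq, add_mul]
  | monomial n a =>
    rw [mulHom_monomial, end_mul_apply, hpow, mulLeft_apply, Polynomial.C_mul_monomial, mul_one,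
      Polynomial.monomial_mul_X]

/-- Right Euclidean division by a monic Ore polynomial. -/
theorem Monic.exists_eq_mul_add {G : OrePoly θ δ} (hG : G.Monic) (Q : OrePoly θ δ) :
    ∃ S R : OrePoly θ δ, Q = S * G + R ∧ R.toPoly.degree < G.toPoly.degree := by
  induction hn : Q.natDegree using Nat.strong_induction_on generalizing Q with
  | _ n ih =>
  by_cases hlt : Q.toPoly.degree < G.toPoly.degree
  · exact ⟨0, Q, by simp, hlt⟩
  have hQ0 : Q ≠ 0 := by
    rintro rfl
    exact hlt (by simpa [bot_lt_iff_ne_bot] using hG.ne_zero ∘ toPoly_eq_zero.mp)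
  have hle : G.natDegree ≤ Q.natDegree := Polynomial.natDegree_le_natDegree (not_lt.mp hlt)
  -- T * G has the leading term of Q: since G is monic, the twist by θ acts on 1 only, and no
  -- inverse of θ is needed.
  set T : OrePoly θ δ := C Q.toPoly.leadingCoeff * X ^ (Q.natDegree - G.natDegree) with hT
  have hlc : Q.toPoly.leadingCoeff ≠ 0 := by
    rwa [Ne, Polynomial.leadingCoeff_eq_zero, toPoly_eq_zero]
  have hC0 : (C Q.toPoly.leadingCoeff : OrePoly θ δ) ≠ 0 := fun h =>
    hlc (Polynomial.C_eq_zero.mp (toPoly_eq_zero.mpr h))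
  have hX := monic_X (θ := θ) (δ := δ) |>.pow (Q.natDegree - G.natDegree)
  have hT0 : T ≠ 0 := mul_ne_zero hC0 hX.ne_zero
  have hTdeg : T.natDegree = Q.natDegree - G.natDegree := by
    rw [hT, natDegree_mul hC0 hX.ne_zero, natDegree_C, natDegree_pow monic_X.ne_zero, natDegree_X]
    omega
  have hTlc : T.toPoly.leadingCoeff = Q.toPoly.leadingCoeff := by
    rw [hT, toPoly_C_mul, Polynomial.leadingCoeff_mul, Polynomial.leadingCoeff_C,
      Polynomial.Monic.leadingCoeff hX, mul_one]
  have hdeg : (T * G).natDegree = Q.natDegree := by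
    rw [natDegree_mul hT0 hG.ne_zero, hTdeg]
    omega
  have hlt' : (Q - T * G).toPoly.degree < Q.toPoly.degree := by
    rw [toPoly_sub]
    refine Polynomial.degree_sub_lt_left ?_ (mt toPoly_eq_zero.mp hQ0) ?_
    · rw [Polynomial.degree_eq_natDegree (mt toPoly_eq_zero.mp hQ0),
        Polynomial.degree_eq_natDegree (mt toPoly_eq_zero.mp (mul_ne_zero hT0 hG.ne_zero))]
      exact congrArg _ hdeg.symm
    · rw [leadingCoeff_mul hT0 hG.ne_zero, Polynomial.Monic.leadingCoeff hG, map_one, mul_one, hTlc]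
  by_cases h0 : Q - T * G = 0
  · refine ⟨T, 0, by rw [add_zero]; exact sub_eq_zero.mp h0, ?_⟩
    rw [toPoly_zero, Polynomial.degree_zero, bot_lt_iff_ne_bot, Ne, Polynomial.degree_eq_bot]
    exact mt toPoly_eq_zero.mp hG.ne_zero
  obtain ⟨S, R, h, hR⟩ := ih (Q - T * G).natDegree
    (hn ▸ Polynomial.natDegree_lt_natDegree (mt toPoly_eq_zero.mp h0) hlt') _ rfl
  exact ⟨T + S, R, by rw [add_mul, add_assoc, ← h]; abel, hR⟩

/-! ### Evaluation at unramified elements -/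

theorem pseudoLinear_apply (c x : K) : pseudoLinear δ c x = δ x + c * θ x := rfl

/-- Evaluation at `c`, as a homomorphism of algebras over the constants. -/
noncomputable def evAlgHom (δ : ThetaDerivation θ) (c : K) :
    OrePoly θ δ →ₐ[δ.constants] Module.End δ.constants K where
  toFun := ev c
  map_one' := by rw [← map_one C, ev_C, one_smul]
  map_mul' := ev_mul c
  map_zero' := by rw [← map_zero C, ev_C, zero_smul]
  map_add' := ev_add c
  commutes' a := (ev_C c (a : K)).trans (by ext x; rfl)

theorem evAlgHom_apply (c : K) (P : OrePoly θ δ) : evAlgHom δ c P = ev c P := rfl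

theorem ev_C_apply (c a x : K) : ev c (C a : OrePoly θ δ) x = a * x := by
  rw [ev_C]; rfl

theorem ev_X (c : K) : ev c (X : OrePoly θ δ) = pseudoLinear δ c := by
  have h := ev_X_mul c (1 : OrePoly θ δ)
  rwa [mul_one, ← evAlgHom_apply c 1, map_one, mul_one] at h

theorem ev_X_apply (c x : K) : ev c (X : OrePoly θ δ) x = δ x + c * θ x := by
  rw [ev_X, pseudoLinear_apply]

theorem ev_sub (c : K) (P Q : OrePoly θ δ) : ev c (P - Q) = ev c P - ev c Q :=
  map_sub (evAlgHom δ c) P Q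

theorem ev_mul_apply (c : K) (P Q : OrePoly θ δ) (x : K) : ev c (P * Q) x = ev c P (ev c Q x) := by
  rw [ev_mul, Module.End.mul_apply]

/-- A scalar commuting with `δ + c θ` is a constant, if `c` is unramified. -/
theorem mem_constants_of_commute {c : K} (hc : ¬ IsRamified δ c) {a : K}
    (h : ∀ x, pseudoLinear δ c (a * x) = a * pseudoLinear δ c x) : a ∈ δ.constants := by
  -- Expanding the commutation by the Leibniz rule; if θ a ≠ a, dividing by θ a - a would exhibit c
  -- as ramified.
  have h' : ∀ x, (θ a - a) * pseudoLinear δ c x = -(δ a) * x := fun x => by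
    have hx := h x
    simp only [pseudoLinear_apply, δ.leibniz, map_mul] at hx ⊢
    linear_combination hx
  have hθ : θ a = a := by
    by_contra hne
    refine hc ⟨-(δ a) / (θ a - a), LinearMap.ext fun x => ?_⟩
    rw [LinearMap.smul_apply, LinearMap.id_apply, smul_eq_mul, div_mul_eq_mul_div,
      eq_div_iff (sub_ne_zero.mpr hne), mul_comm, h']
  refine ⟨hθ, ?_⟩
  have h1 := h' 1
  rw [hθ, sub_self, zero_mul, mul_one] at h1
  exact neg_eq_zero.mp h1.symm

theorem upsilon_eq_ev (Z : OrePoly θ δ) (c : K) : Z.upsilon c = ev c Z 1 := by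
  obtain ⟨Q, hQ⟩ := Z.remainder_spec c
  have h1 : ev c (X - C c : OrePoly θ δ) 1 = 0 := by
    rw [ev_sub, LinearMap.sub_apply, ev_X_apply, ev_C_apply, δ.map_one, map_one]
    ring
  conv_rhs => rw [hQ]
  rw [ev_add, LinearMap.add_apply, ev_mul_apply, h1, _root_.map_zero, zero_add, ev_C_apply, mul_one]
  rfl

/-- As Z commutes with the constant x, its evaluation commutes with multiplication by x, so it is
multiplication by its value at 1, which is υ(c). -/
theorem ev_apply_of_central {Z : OrePoly θ δ} (hZ : ∀ P, Z * P = P * Z) (c x : K) :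
    ev c Z x = Z.upsilon c * x := by
  have h := ev_mul_apply c Z (C x) 1
  rw [hZ, ev_mul_apply, ev_C_apply, ev_C_apply, mul_one] at h
  rw [← h, upsilon_eq_ev, mul_comm]

/-- Multiplication by υ(c) is the evaluation of a central element, so it commutes with δ + c θ, the
evaluation of X. -/
theorem upsilon_mem_constants {Z : OrePoly θ δ} (hZ : ∀ P, Z * P = P * Z) {c : K}
    (hc : ¬ IsRamified δ c) : Z.upsilon c ∈ δ.constants := by
  refine mem_constants_of_commute hc fun x => ?_
  rw [← ev_apply_of_central hZ, ← ev_apply_of_central hZ, ← ev_X, ← ev_mul_apply, ← ev_mul_apply,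
    hZ]

/-- Evaluation at an unramified element is surjective. -/
theorem ev_surjective [FiniteDimensional δ.constants K] {c : K} (hc : ¬ IsRamified δ c) :
    Function.Surjective (ev c : OrePoly θ δ → Module.End δ.constants K) := by
  intro f
  let _ : Module (OrePoly θ δ) K := Module.compHom K (evAlgHom δ c).toRingHom
  have hsmul : ∀ (P : OrePoly θ δ) (x : K), P • x = ev c P x := fun _ _ => rfl
  -- The constant polynomials alone already carry any nonzero vector of K to any other vector.
  have : IsSimpleModule (OrePoly θ δ) K := by
    rw [isSimpleModule_iff_toSpanSingleton_surjective]
    refine ⟨inferInstance, fun x hx y => ⟨C (y / x), ?_⟩⟩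
    rw [LinearMap.toSpanSingleton_apply, hsmul, ev_C_apply, div_mul_cancel₀ _ hx]
  -- An endomorphism commutes with K, so it is multiplication by g 1; it also commutes with δ + c θ,
  -- which puts g 1 in F.
  have hg : ∀ g : Module.End (OrePoly θ δ) K, ∃ a : δ.constants, ∀ x, g x = a • x := by
    intro g
    have h1 : ∀ x, g x = g 1 * x := fun x => by
      have h := g.map_smul (C x) 1
      rwa [hsmul, hsmul, ev_C_apply, ev_C_apply, mul_one, mul_comm] at h
    refine ⟨⟨g 1, mem_constants_of_commute hc fun x => ?_⟩, h1⟩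
    rw [← h1, ← h1, ← ev_X, ← hsmul, ← hsmul, g.map_smul]
  let f' : Module.End (Module.End (OrePoly θ δ) K) K :=
    { toFun := f
      map_add' := f.map_add
      map_smul' := fun g x => by
        obtain ⟨a, ha⟩ := hg g
        rw [Module.End.smul_def, ha, f.map_smul, RingHom.id_apply, Module.End.smul_def, ha] }
  obtain ⟨s, hs⟩ := Module.Finite.fg_top (R := δ.constants) (M := K)
  -- Density gives agreement with f on a finite spanning set, hence everywhere by F-linearity.
  obtain ⟨P, hP⟩ := jacobson_density (R := OrePoly θ δ) f' s
  exact ⟨P, LinearMap.ext_on hs fun x hx => (hP x hx).symm⟩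

/-- Evaluation at finitely many unramified elements separated by a central element. -/
theorem exists_forall_ev_eq [FiniteDimensional δ.constants K] {Z : OrePoly θ δ}
    (hZ : ∀ P, Z * P = P * Z) {m : ℕ} {c : Fin m → K} (hc : ∀ i, ¬ IsRamified δ (c i))
    (hυ : ∀ i j, i ≠ j → Z.upsilon (c i) ≠ Z.upsilon (c j))
    (T : Fin m → Module.End δ.constants K) : ∃ P : OrePoly θ δ, ∀ i, ev (c i) P = T i := by
  choose Q hQ using fun i => ev_surjective (hc i) (T i)
  let v : Fin m → δ.constants := fun i => ⟨Z.upsilon (c i), upsilon_mem_constants hZ (hc i)⟩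
  have hv : Set.InjOn v (Finset.univ : Finset (Fin m)) := fun i _ j _ h => by
    by_contra hij
    exact hυ i j hij (congrArg Subtype.val h)
  -- The evaluation of E j is the identity at c j and zero at the other points.
  let E : Fin m → OrePoly θ δ := fun j => Polynomial.aeval Z (Lagrange.basis Finset.univ v j)
  have hev : ∀ (i : Fin m) (p : δ.constants[X]),
      ev (c i) (Polynomial.aeval Z p) = algebraMap _ _ (p.eval (v i)) := fun i p => by
    have hZi : evAlgHom δ (c i) Z = algebraMap _ _ (v i) :=
      LinearMap.ext fun x => ev_apply_of_central hZ (c i) x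
    rw [← evAlgHom_apply, ← Polynomial.aeval_algHom_apply, hZi,
      Polynomial.aeval_algebraMap_apply, Polynomial.coe_aeval_eq_eval]
  refine ⟨∑ j, Q j * E j, fun i => ?_⟩
  rw [← evAlgHom_apply, map_sum, Finset.sum_eq_single i]
  · rw [map_mul, evAlgHom_apply, evAlgHom_apply, hev,
      Lagrange.eval_basis_self hv (Finset.mem_univ i), map_one, mul_one, hQ]
  · intro j _ hji
    rw [map_mul, evAlgHom_apply _ (E j), hev,
      Lagrange.eval_basis_of_ne hji (Finset.mem_univ i), map_zero, mul_zero]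
  · exact fun h => (h (Finset.mem_univ i)).elim

/-! ### Annihilators as principal left ideals -/

/-- The kernel of a surjective linear map from `K[X; θ, δ]` onto a finite-dimensional space,
if it is a left ideal, is generated by a monic polynomial of the degree one expects. -/
theorem exists_monic_generator {W : Type*} [AddCommGroup W] [Module K W] [FiniteDimensional K W]
    (Φ : K[X] →ₗ[K] W) (hΦ : Function.Surjective Φ)
    (hmul : ∀ S P : OrePoly θ δ, Φ P.toPoly = 0 → Φ (S * P).toPoly = 0) :
    ∃ G : OrePoly θ δ, G.Monic ∧ G.natDegree = Module.finrank K W ∧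
      ∀ P : OrePoly θ δ, Φ P.toPoly = 0 ↔ ∃ S, P = S * G := by
  classical
  have hex : ∃ n, ∃ G : OrePoly θ δ, G.Monic ∧ Φ G.toPoly = 0 ∧ G.natDegree = n := by
    have hker : LinearMap.ker Φ ≠ ⊥ := fun h => by
      have := FiniteDimensional.of_injective Φ (LinearMap.ker_eq_bot.mp h)
      exact Polynomial.not_finite (R := K) this
    obtain ⟨p, hp, hp0⟩ := Submodule.exists_mem_ne_zero_of_ne_bot hker
    refine ⟨_, ⟨Polynomial.C p.leadingCoeff⁻¹ * p⟩, ?_, ?_, rfl⟩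
    · rw [OrePoly.Monic, mul_comm]
      exact Polynomial.monic_mul_leadingCoeff_inv hp0
    · rw [← Polynomial.smul_eq_C_mul, map_smul, LinearMap.mem_ker.mp hp, smul_zero]
  obtain ⟨G, hG, hG0, hGn⟩ := Nat.find_spec hex
  have hmin : ∀ P : OrePoly θ δ, Φ P.toPoly = 0 → P.toPoly.degree < G.toPoly.degree → P = 0 := by
    intro P hP hlt
    by_contra hP0
    have hP0' : P.toPoly ≠ 0 := mt toPoly_eq_zero.mp hP0
    refine Nat.find_min hex (m := P.natDegree) ?_
      ⟨⟨Polynomial.C P.toPoly.leadingCoeff⁻¹ * P.toPoly⟩, ?_, ?_, ?_⟩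
    · rw [← hGn]
      exact Polynomial.natDegree_lt_natDegree hP0' hlt
    · rw [OrePoly.Monic, mul_comm]
      exact Polynomial.monic_mul_leadingCoeff_inv hP0'
    · rw [← Polynomial.smul_eq_C_mul, map_smul, hP, smul_zero]
    · exact Polynomial.natDegree_C_mul
        (inv_ne_zero (Polynomial.leadingCoeff_ne_zero.mpr hP0'))
  refine ⟨G, hG, ?_, fun P => ⟨fun hP => ?_, ?_⟩⟩
  -- Polynomials of degree less than deg G are representatives modulo the kernel: minimality of deg
  -- G gives injectivity, division by G gives surjectivity. So deg G is the dimension of W.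
  · let Ψ : Polynomial.degreeLT K G.natDegree →ₗ[K] W := Φ.domRestrict _
    have hdeg : ∀ p : K[X], p ∈ Polynomial.degreeLT K G.natDegree ↔ p.degree < G.toPoly.degree := by
      intro p
      rw [Polynomial.mem_degreeLT, Polynomial.degree_eq_natDegree (Polynomial.Monic.ne_zero hG)]
      rfl
    have hinj : Function.Injective Ψ := by
      rw [injective_iff_map_eq_zero]
      rintro ⟨p, hp⟩ h
      exact Subtype.ext (congrArg toPoly (hmin ⟨p⟩ h ((hdeg p).mp hp)))
    have hsurj : Function.Surjective Ψ := by
      intro w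
      obtain ⟨p, rfl⟩ := hΦ w
      obtain ⟨S, R, hp, hR⟩ := hG.exists_eq_mul_add ⟨p⟩
      refine ⟨⟨R.toPoly, (hdeg _).mpr hR⟩, ?_⟩
      have h : p = (S * G).toPoly + R.toPoly := congrArg toPoly hp
      rw [h, map_add, hmul S G hG0, zero_add]
      rfl
    rw [← (LinearEquiv.ofBijective Ψ ⟨hinj, hsurj⟩).finrank_eq,
      (Polynomial.degreeLTEquiv K G.natDegree).finrank_eq, Module.finrank_fin_fun]
  · obtain ⟨S, R, hp, hR⟩ := hG.exists_eq_mul_add P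
    have hR0 : R = 0 := by
      refine hmin R ?_ hR
      rwa [hp, toPoly_add, map_add, hmul S G hG0, zero_add] at hP
    exact ⟨S, by rw [hp, hR0, add_zero]⟩
  · rintro ⟨S, rfl⟩
    exact hmul S G hG0

/-- Restriction of the evaluations at the `c i` to the subspaces `V i`. -/
noncomputable def evRestrict (δ : ThetaDerivation θ) {m : ℕ} (c : Fin m → K)
    (V : Fin m → Submodule δ.constants K) : K[X] →ₗ[K] (i : Fin m) → (V i →ₗ[δ.constants] K) where
  toFun p i := (ev (c i) (⟨p⟩ : OrePoly θ δ)).domRestrict (V i)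
  map_add' p q := by
    funext i
    change (ev (c i) (⟨p⟩ + ⟨q⟩ : OrePoly θ δ)).domRestrict (V i) = _
    rw [ev_add]
    rfl
  map_smul' a p := by
    funext i
    have h : (⟨a • p⟩ : OrePoly θ δ) = C a * ⟨p⟩ := by
      ext1
      rw [toPoly_C_mul, Polynomial.smul_eq_C_mul]
    rw [h, ev_C_mul]
    rfl

theorem evRestrict_eq_zero {m : ℕ} {c : Fin m → K} {V : Fin m → Submodule δ.constants K}
    {P : OrePoly θ δ} :
    evRestrict δ c V P.toPoly = 0 ↔ ∀ i, ∀ x ∈ V i, ev (c i) P x = 0 := by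
  rw [funext_iff]
  refine forall_congr' fun i => ?_
  rw [LinearMap.ext_iff, Subtype.forall]
  rfl

/-- The annihilator of a family of subspaces is generated by a monic polynomial, whose degree is the
sum of their dimensions. -/
theorem exists_annihilator [FiniteDimensional δ.constants K] {Z : OrePoly θ δ}
    (hZ : ∀ P, Z * P = P * Z) {m : ℕ} {c : Fin m → K} (hc : ∀ i, ¬ IsRamified δ (c i))
    (hυ : ∀ i j, i ≠ j → Z.upsilon (c i) ≠ Z.upsilon (c j))
    (V : Fin m → Submodule δ.constants K) :
    ∃ G : OrePoly θ δ, G.Monic ∧ G.natDegree = ∑ i, Module.finrank δ.constants (V i) ∧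
      ∀ P : OrePoly θ δ, (∀ i, ∀ x ∈ V i, ev (c i) P x = 0) ↔ ∃ S, P = S * G := by
  have hsurj : Function.Surjective (evRestrict δ c V) := by
    intro w
    choose T hT using fun i => LinearMap.exists_extend (w i)
    obtain ⟨P, hP⟩ := exists_forall_ev_eq hZ hc hυ T
    refine ⟨P.toPoly, funext fun i => ?_⟩
    rw [← hT i, ← hP i]
    rfl
  have hfin (i : Fin m) : FiniteDimensional K (V i →ₗ[δ.constants] K) := inferInstance
  have : FiniteDimensional K ((i : Fin m) → (V i →ₗ[δ.constants] K)) := Module.Finite.pi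
  obtain ⟨G, hG, hdeg, hker⟩ := exists_monic_generator (θ := θ) (δ := δ) (evRestrict δ c V) hsurj
    fun S P hP => by
      rw [evRestrict_eq_zero] at hP ⊢
      intro i x hx
      rw [ev_mul_apply, hP i x hx, _root_.map_zero]
  refine ⟨G, hG, ?_, fun P => evRestrict_eq_zero.symm.trans (hker P)⟩
  rw [hdeg, Module.finrank_pi_fintype]
  exact Finset.sum_congr rfl fun i _ => Module.finrank_linearMap_self _ _ _

/-- The kernel of the evaluation at an unramified element. -/
theorem exists_ker_ev_generator [FiniteDimensional δ.constants K] {c : K}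
    (hc : ¬ IsRamified δ c) :
    ∃ G : OrePoly θ δ, G.Monic ∧ G.natDegree = Module.finrank δ.constants K ∧
      ∀ P : OrePoly θ δ, ev c P = 0 ↔ ∃ S, P = S * G := by
  -- With a single point there is nothing to separate, so the central element 0 will do.
  obtain ⟨G, hG, hdeg, hker⟩ := exists_annihilator (θ := θ) (δ := δ) (Z := 0) (m := 1)
    (fun P => by rw [zero_mul, mul_zero]) (c := fun _ => c) (fun _ => hc)
    (fun i j hij => (hij (Subsingleton.elim i j)).elim) (fun _ => ⊤)
  refine ⟨G, hG, by simpa using hdeg, fun P => ?_⟩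
  rw [← hker, LinearMap.ext_iff]
  simp

theorem Monic.of_mul_right {S G : OrePoly θ δ} (hG : G.Monic) (h : (S * G).Monic) : S.Monic := by
  have hS : S ≠ 0 := left_ne_zero_of_mul h.ne_zero
  have hlc := leadingCoeff_mul hS hG.ne_zero
  rw [Polynomial.Monic.leadingCoeff hG, Polynomial.Monic.leadingCoeff h, map_one, mul_one] at hlc
  exact hlc.symm

/-- A monic left multiple of a monic polynomial of the same degree is equal to it. -/
theorem Monic.eq_of_eq_mul {P S G : OrePoly θ δ} (hP : P.Monic) (hG : G.Monic)
    (hdeg : P.natDegree = G.natDegree) (h : P = S * G) : P = G := by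
  subst h
  have hS := hG.of_mul_right hP
  rw [natDegree_mul hS.ne_zero hG.ne_zero] at hdeg
  rw [hS.eq_one_of_natDegree_eq_zero (by omega), one_mul]

/-! ### The centre and the degree of its generator -/

/-- An Ore polynomial commuting with the constants of `K` and with `X` is central. -/
theorem central_of_commute {Z : OrePoly θ δ} (hC : ∀ a, Z * C a = C a * Z) (hX : Z * X = X * Z)
    (P : OrePoly θ δ) : Z * P = P * Z := by
  induction P using induction_X with
  | hC a => exact hC a
  | hadd P Q hP hQ => rw [mul_add, add_mul, hP, hQ]
  | hCmul a P hP => rw [← mul_assoc, hC, mul_assoc, hP, mul_assoc]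
  | hX P hP => rw [← mul_assoc, hX, mul_assoc, hP, mul_assoc]

theorem sub_upsilon_comm {Z : OrePoly θ δ} (hZ : ∀ P, Z * P = P * Z) {c : K}
    (hc : ¬ IsRamified δ c) (P : OrePoly θ δ) :
    (Z - C (Z.upsilon c)) * P = P * (Z - C (Z.upsilon c)) := by
  rw [sub_mul, mul_sub, hZ, C_mul_comm (upsilon_mem_constants hZ hc)]

theorem ev_sub_upsilon {Z : OrePoly θ δ} (hZ : ∀ P, Z * P = P * Z) (c : K) :
    ev c (Z - C (Z.upsilon c)) = 0 := by
  ext x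
  rw [ev_sub, LinearMap.sub_apply, ev_C_apply, ev_apply_of_central hZ, sub_self,
    LinearMap.zero_apply]

/-- For θ = id, commuting with X differentiates the coefficients; the degree does not rise, and a
leading coefficient 1 is killed. -/
theorem toPoly_X_mul_sub_mul_X (hθ : ∀ a, θ a = a) (G : OrePoly θ δ) (k : ℕ) :
    (X * G - G * X).toPoly.coeff k = δ (G.toPoly.coeff k) := by
  rw [toPoly_sub, toPoly_X_mul, toPoly_mul_X, Polynomial.coeff_sub]
  cases k with
  | zero => rw [coeff_xMul_zero, Polynomial.coeff_mul_X_zero, sub_zero]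
  | succ k => rw [coeff_xMul_succ, Polynomial.coeff_mul_X, hθ, add_sub_cancel_left]

/-- When `θ` is the identity, the monic generator of the kernel of an evaluation is central. -/
theorem exists_central_of_theta_eq_id [FiniteDimensional δ.constants K] (hθ : ∀ a, θ a = a) {c : K}
    (hc : ¬ IsRamified δ c) : ∃ W : OrePoly θ δ, W.Monic ∧ (∀ P, W * P = P * W) ∧
      W.natDegree = Module.finrank δ.constants K := by
  obtain ⟨G, hG, hdeg, hker⟩ := exists_ker_ev_generator (θ := θ) (δ := δ) hc
  -- Nonzero left multiples of G have degree at least deg G. This is applied to the commutators of G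
  -- with constants and with X, which `ev c` kills because it kills G.
  have hzero : ∀ P : OrePoly θ δ, ev c P = 0 → P.natDegree ≤ G.natDegree →
      P.toPoly.coeff G.natDegree = 0 → P = 0 := by
    intro P hP hle h0
    by_contra hne
    obtain ⟨S, rfl⟩ := (hker P).mp hP
    have hS := left_ne_zero_of_mul hne
    rw [natDegree_mul hS hG.ne_zero] at hle
    have h := coeff_mul_natDegree_add_ne_zero hS hG.ne_zero
    rw [show S.natDegree = 0 by omega, zero_add] at h
    exact h h0
  have hG0 : ev c G = 0 := (hker G).mpr ⟨1, (one_mul G).symm⟩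
  have hlc : G.toPoly.coeff G.natDegree = 1 := hG
  have hpow : ∀ (n : ℕ) (a : K), (θ ^ n) a = a := fun n a => by
    rw [show θ = 1 from RingHom.ext hθ, one_pow]
    rfl
  refine ⟨G, hG, central_of_commute (fun a => sub_eq_zero.mp (hzero _ ?_ ?_ ?_)) (Eq.symm
    (sub_eq_zero.mp (hzero _ ?_ ?_ ?_))), hdeg⟩
  · rw [ev_sub, ev_mul, ev_mul, hG0, zero_mul, mul_zero, sub_zero]
  · refine (Polynomial.natDegree_sub_le _ _).trans (max_le ?_ ?_)
    · exact natDegree_mulHom_le (n := G.natDegree) (d := 0) le_rfl (natDegree_C a).le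
    · exact (natDegree_mulHom_le (n := 0) (d := G.natDegree) (natDegree_C a).le le_rfl).trans
        (zero_add _).le
  · have h := coeff_mulHom (θ := θ) (δ := δ) (P := G.toPoly) (n := G.natDegree) (d := 0) le_rfl
      (natDegree_C (θ := θ) (δ := δ) a).le
    rw [toPoly_sub, Polynomial.coeff_sub, toPoly_C_mul, Polynomial.coeff_C_mul, hlc, mul_one,
      toPoly_mul, sub_eq_zero]
    rw [add_zero, hlc, one_mul, hpow, toPoly_C, Polynomial.coeff_C_zero] at h
    exact h
  · rw [ev_sub, ev_mul, ev_mul, hG0, zero_mul, mul_zero, sub_zero]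
  · rw [natDegree, Polynomial.natDegree_le_iff_coeff_eq_zero]
    intro k hk
    rw [toPoly_X_mul_sub_mul_X hθ, Polynomial.coeff_eq_zero_of_natDegree_lt hk, δ.map_zero]
  · rw [toPoly_X_mul_sub_mul_X hθ, hlc, δ.map_one]

/-- When `θ` is not the identity, `δ` is inner. -/
theorem exists_inner (h : ∃ b, θ b ≠ b) : ∃ u : K, ∀ a, δ a = u * (θ a - a) := by
  obtain ⟨b, hb⟩ := h
  have hb' := sub_ne_zero.mpr hb
  refine ⟨δ b / (θ b - b), fun a => ?_⟩
  -- Comparing δ(ab) with δ(ba) gives δ(a)(θ(b) − b) = δ(b)(θ(a) − a).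
  have h1 := δ.leibniz a b
  rw [mul_comm a b, δ.leibniz] at h1
  field_simp
  linear_combination h1

/-- If `δ` is inner, then `θ` has order `[K : F]`. -/
theorem theta_pow_finrank [FiniteDimensional δ.constants K] {u : K}
    (hu : ∀ a, δ a = u * (θ a - a)) (a : K) :
    (θ ^ Module.finrank δ.constants K) a = a := by
  let φ : K →ₐ[δ.constants] K := { θ with commutes' := fun a => a.2.1 }
  let σ : K ≃ₐ[δ.constants] K := AlgEquiv.ofBijective φ φ.bijective
  have hσ : ∀ x, σ x = θ x := fun _ => rfl
  let H := Subgroup.zpowers σ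
  -- An inner δ vanishes wherever θ fixes, so F is the fixed field of θ and Artin's theorem gives
  -- the order of σ.
  have hbot : IntermediateField.fixedField H = ⊥ := by
    rw [eq_bot_iff]
    intro x hx
    have hx' : θ x = x := (IntermediateField.mem_fixedField_iff H x).mp hx σ
      (Subgroup.mem_zpowers σ)
    rw [IntermediateField.mem_bot]
    exact ⟨⟨x, hx', by rw [hu, hx', sub_self, mul_zero]⟩, rfl⟩
  have hcard : Module.finrank δ.constants K = orderOf σ := by
    have h := IntermediateField.finrank_fixedField_eq_card H
    rw [hbot, IntermediateField.finrank_bot', Nat.card_zpowers] at h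
    exact h
  have hpow : ∀ (n : ℕ) (x : K), (σ ^ n) x = (θ ^ n) x := by
    intro n
    induction n with
    | zero => intro x; rfl
    | succ n ih => intro x; rw [pow_succ, pow_succ, AlgEquiv.mul_apply, ih]; rfl
  rw [← hpow, hcard, pow_orderOf_eq_one]
  rfl

/-- The change of variable Y = X + u absorbs the derivation: Y a = θ(a) Y. As θ ^ r = id, Y ^ r is
central. -/
theorem exists_central_of_inner [FiniteDimensional δ.constants K] {u : K}
    (hu : ∀ a, δ a = u * (θ a - a)) : ∃ W : OrePoly θ δ, W.Monic ∧ (∀ P, W * P = P * W) ∧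
      W.natDegree = Module.finrank δ.constants K := by
  set Y : OrePoly θ δ := X + C u with hY
  have hYm : Y.Monic := monic_X.add_C (by rw [natDegree_X]; exact one_pos) u
  have hYd : Y.natDegree = 1 := (natDegree_add_C X u).trans natDegree_X
  have hYC : ∀ a, Y * C a = C (θ a) * Y := fun a => by
    rw [hY, add_mul, X_mul_C, mul_add, hu, ← map_mul, ← map_mul, add_assoc, ← map_add]
    congr 2
    ring
  have hpow : ∀ (n : ℕ) (a : K), Y ^ n * C a = C ((θ ^ n) a) * Y ^ n := by
    intro n
    induction n with
    | zero => intro a; simp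
    | succ n ih =>
      intro a
      rw [pow_succ, mul_assoc, hYC, ← mul_assoc, ih, mul_assoc, pow_succ θ]
      rfl
  have hC : ∀ a, Y ^ Module.finrank δ.constants K * C a =
      C a * Y ^ Module.finrank δ.constants K := fun a => by
    rw [hpow, theta_pow_finrank hu]
  refine ⟨Y ^ Module.finrank δ.constants K, hYm.pow _, central_of_commute hC ?_, ?_⟩
  · have hX : (X : OrePoly θ δ) = Y - C u := (add_sub_cancel_right X (C u)).symm
    rw [hX, mul_sub, sub_mul, hC, ← pow_succ, ← pow_succ']
  · rw [natDegree_pow hYm.ne_zero, hYd, mul_one]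

theorem exists_central [FiniteDimensional δ.constants K] {c : K} (hc : ¬ IsRamified δ c) :
    ∃ W : OrePoly θ δ, W.Monic ∧ (∀ P, W * P = P * W) ∧
      W.natDegree = Module.finrank δ.constants K := by
  by_cases h : ∃ b, θ b ≠ b
  · obtain ⟨u, hu⟩ := exists_inner (δ := δ) h
    exact exists_central_of_inner hu
  · push Not at h
    exact exists_central_of_theta_eq_id h hc

theorem mem_center_iff {P : OrePoly θ δ} :
    P ∈ Subalgebra.center δ.constants (OrePoly θ δ) ↔ ∀ Q, P * Q = Q * P :=
  Subalgebra.mem_center_iff.trans (forall_congr' fun _ => eq_comm)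

/-- By degree, W - υ(c) is the generator G of the kernel of `ev c`. A central P then satisfies P -
υ_P(c) = Q G with Q again central, of smaller degree if nonzero, and induction writes P as a
polynomial in W over F. -/
theorem isCentreGenerator_of_central [FiniteDimensional δ.constants K] {c : K}
    (hc : ¬ IsRamified δ c) {W : OrePoly θ δ} (hW : W.Monic) (hcen : ∀ P, W * P = P * W)
    (hdeg : W.natDegree = Module.finrank δ.constants K) : W.IsCentreGenerator := by
  have hpos : 0 < Module.finrank δ.constants K := Module.finrank_pos
  refine ⟨hW, le_antisymm ?_ ?_⟩
  · obtain ⟨G, hG, hGdeg, hker⟩ := exists_ker_ev_generator (θ := θ) (δ := δ) hc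
    have hC : ∀ a ∈ δ.constants, (C a : OrePoly θ δ) ∈ Algebra.adjoin δ.constants {W} :=
      fun a ha => Subalgebra.algebraMap_mem _ (⟨a, ha⟩ : δ.constants)
    obtain ⟨S, hS⟩ := (hker _).mp (ev_sub_upsilon hcen c)
    have hWG : W - C (W.upsilon c) = G :=
      (hW.sub_C (hdeg ▸ hpos) _).eq_of_eq_mul hG
        (by rw [natDegree_sub_C, hdeg, hGdeg]) hS
    have hGcen : ∀ P, G * P = P * G := hWG ▸ sub_upsilon_comm hcen hc
    have hGmem : G ∈ Algebra.adjoin δ.constants {W} := by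
      rw [← hWG]
      exact sub_mem (Algebra.subset_adjoin rfl) (hC _ (upsilon_mem_constants hcen hc))
    intro P hP
    rw [mem_center_iff] at hP
    induction hn : P.natDegree using Nat.strong_induction_on generalizing P with
    | _ n ih =>
    obtain ⟨Q, hQ⟩ := (hker _).mp (ev_sub_upsilon hP c)
    have hPQ : P = Q * G + C (P.upsilon c) := by rw [← hQ, sub_add_cancel]
    have hmem : Q ∈ Algebra.adjoin δ.constants {W} := by
      by_cases hQ0 : Q = 0
      · rw [hQ0]; exact zero_mem _
      refine ih Q.natDegree ?_ (fun R => ?_) rfl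
      · have h := natDegree_mul hQ0 hG.ne_zero
        rw [← hQ, natDegree_sub_C] at h
        omega
      · have h := sub_upsilon_comm hP hc R
        rw [hQ, mul_assoc, hGcen, ← mul_assoc, ← mul_assoc] at h
        exact mul_right_cancel₀ hG.ne_zero h
    rw [hPQ]
    exact add_mem (mul_mem hmem hGmem) (hC _ (upsilon_mem_constants hP hc))
  · rw [Algebra.adjoin_le_iff, Set.singleton_subset_iff]
    exact mem_center_iff.mpr hcen

theorem natDegree_dvd_of_mem_adjoin {Z P : OrePoly θ δ}
    (hP : P ∈ Algebra.adjoin δ.constants {Z}) : Z.natDegree ∣ P.natDegree := by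
  rw [Algebra.adjoin_singleton_eq_range_aeval] at hP
  obtain ⟨p, rfl⟩ := hP
  change _ ∣ (Polynomial.aeval Z p).natDegree
  induction p using Polynomial.recOnHorner with
  | M0 => rw [map_zero]; exact dvd_zero _
  | MC p a _ _ ih =>
    rw [map_add, Polynomial.aeval_C]
    exact ih.trans (natDegree_add_C _ (a : K)).symm.dvd
  | MX p _ ih =>
    rw [map_mul, Polynomial.aeval_X]
    by_cases h : Polynomial.aeval Z p * Z = 0
    · rw [h]; exact dvd_zero _
    · rw [natDegree_mul (left_ne_zero_of_mul h) (right_ne_zero_of_mul h)]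
      exact dvd_add ih dvd_rfl

theorem IsCentreGenerator.comm {Z : OrePoly θ δ} (hZ : Z.IsCentreGenerator) (P : OrePoly θ δ) :
    Z * P = P * Z :=
  mem_center_iff.mp (hZ.2 ▸ Algebra.subset_adjoin rfl) P

/-- Z and the central W of degree r generate the same algebra, so their degrees divide each other.
-/
theorem IsCentreGenerator.natDegree_eq [FiniteDimensional δ.constants K] {Z : OrePoly θ δ}
    (hZ : Z.IsCentreGenerator) {c : K} (hc : ¬ IsRamified δ c) :
    Z.natDegree = Module.finrank δ.constants K := by
  obtain ⟨W, hW, hcen, hdeg⟩ := exists_central (θ := θ) (δ := δ) hc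
  have hWg := isCentreGenerator_of_central hc hW hcen hdeg
  rw [← hdeg]
  refine Nat.dvd_antisymm (natDegree_dvd_of_mem_adjoin ?_) (natDegree_dvd_of_mem_adjoin ?_)
  · rw [← hZ.2]; exact mem_center_iff.mpr hcen
  · rw [← hWg.2]; exact mem_center_iff.mpr hZ.comm

theorem exists_isCentreGenerator [FiniteDimensional δ.constants K] :
    ∃ Z : OrePoly θ δ, Z.IsCentreGenerator := by
  by_cases h : ∃ c, ¬ IsRamified δ c
  · obtain ⟨c, hc⟩ := h
    obtain ⟨W, hW, hcen, hdeg⟩ := exists_central (θ := θ) (δ := δ) hc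
    exact ⟨W, isCentreGenerator_of_central hc hW hcen hdeg⟩
  -- If every c is ramified, c = 0 forces δ = 0 and then c = 1 forces θ = id: the ring is the
  -- commutative F[X] with F = K, and Z = X.
  push Not at h
  have hδ : ∀ x, δ x = 0 := fun x => by
    obtain ⟨a, ha⟩ := h 0
    have h1 := LinearMap.congr_fun ha 1
    have hx := LinearMap.congr_fun ha x
    simp only [pseudoLinear_apply, LinearMap.smul_apply, LinearMap.id_apply, smul_eq_mul,
      δ.map_one, zero_mul, add_zero, mul_one] at h1 hx
    rw [hx, ← h1, zero_mul]
  have hθ : ∀ x, θ x = x := fun x => by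
    obtain ⟨a, ha⟩ := h 1
    have h1 := LinearMap.congr_fun ha 1
    have hx := LinearMap.congr_fun ha x
    simp only [pseudoLinear_apply, LinearMap.smul_apply, LinearMap.id_apply, smul_eq_mul,
      hδ, one_mul, zero_add, mul_one, map_one] at h1 hx
    rw [hx, ← h1, one_mul]
  have hC : ∀ a, (C a : OrePoly θ δ) ∈ Algebra.adjoin δ.constants {(X : OrePoly θ δ)} :=
    fun a => Subalgebra.algebraMap_mem _ (⟨a, hθ a, hδ a⟩ : δ.constants)
  have hX : (X : OrePoly θ δ) ∈ Algebra.adjoin δ.constants {(X : OrePoly θ δ)} :=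
    Algebra.subset_adjoin rfl
  refine ⟨X, monic_X, le_antisymm (fun P hP => ?_) ?_⟩
  · clear hP
    induction P using induction_X with
    | hC a => exact hC a
    | hadd P Q hP hQ => exact add_mem hP hQ
    | hCmul a P hP => exact mul_mem (hC a) hP
    | hX P hP => exact mul_mem hX hP
  · rw [Algebra.adjoin_le_iff, Set.singleton_subset_iff]
    refine mem_center_iff.mpr (central_of_commute (fun a => ?_) rfl)
    rw [X_mul_C, hθ, hδ, map_zero, add_zero]

/-! ### The central product and the two assertions -/

theorem list_prod_monic_central {r : ℕ} (L : List (OrePoly θ δ))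
    (hL : ∀ N ∈ L, N.Monic ∧ N.natDegree = r ∧ ∀ P, N * P = P * N) :
    L.prod.Monic ∧ L.prod.natDegree = L.length * r ∧ ∀ P, L.prod * P = P * L.prod := by
  induction L with
  | nil => simp [monic_one, natDegree_one]
  | cons N L ih =>
    obtain ⟨h1, h2, h3⟩ := ih fun N' h => hL N' (List.mem_cons_of_mem _ h)
    obtain ⟨g1, g2, g3⟩ := hL N List.mem_cons_self
    rw [List.prod_cons, natDegree_mul g1.ne_zero h1.ne_zero, g2, h2, List.length_cons]
    exact ⟨g1.mul h1, by ring, fun P => by rw [mul_assoc, h3, ← mul_assoc, g3, mul_assoc]⟩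

end OrePoly

theorem LinearMap.exists_comp_eq_of_ker_le {F V W U : Type*} [Field F] [AddCommGroup V]
    [AddCommGroup W] [AddCommGroup U] [Module F V] [Module F W] [Module F U]
    (f : V →ₗ[F] W) (g : V →ₗ[F] U) (h : LinearMap.ker f ≤ LinearMap.ker g) :
    ∃ t : W →ₗ[F] U, t ∘ₗ f = g := by
  obtain ⟨t, ht⟩ := LinearMap.exists_extend
    ((LinearMap.ker f).liftQ g h ∘ₗ f.quotKerEquivRange.symm.toLinearMap)
  refine ⟨t, LinearMap.ext fun x => ?_⟩
  have hx := LinearMap.congr_fun ht (f.rangeRestrict x)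
  have e : f.quotKerEquivRange.symm (f.rangeRestrict x) = Submodule.Quotient.mk x := by
    rw [LinearEquiv.symm_apply_eq]
    rfl
  exact hx.trans (by
    rw [LinearMap.comp_apply, LinearEquiv.coe_coe, e, Submodule.liftQ_apply])

open OrePoly in
theorem mainTheorem5 {K : Type*} [Field K] (θ : K →+* K) (δ : ThetaDerivation θ)
    [FiniteDimensional δ.constants K] :
    (∃ Z : OrePoly θ δ, Z.IsCentreGenerator) ∧
    ∀ Z : OrePoly θ δ, Z.IsCentreGenerator →
      ∀ (m : ℕ) (c : Fin m → K), (∀ i, ¬ OrePoly.IsRamified δ (c i)) →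
        (∀ i j, i ≠ j → Z.upsilon (c i) ≠ Z.upsilon (c j)) →
        (∀ P : OrePoly θ δ, P ≠ 0 →
          (∑ i, Module.finrank δ.constants (LinearMap.ker (OrePoly.ev (c i) P)) ≤ P.natDegree ∧
          (∑ i, Module.finrank δ.constants (LinearMap.ker (OrePoly.ev (c i) P)) = P.natDegree ↔
            P ∣ (List.ofFn fun i => Z - OrePoly.C (Z.upsilon (c i))).prod))) ∧
        (∀ V : Fin m → Submodule δ.constants K,
          ∃! P : OrePoly θ δ, P.Monic ∧
            P.natDegree = ∑ i, Module.finrank δ.constants (V i) ∧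
            ∀ i, ∀ x ∈ V i, OrePoly.ev (c i) P x = 0) := by
  refine ⟨exists_isCentreGenerator, fun Z hZg m c hc hυ => ⟨fun P hP => ?_, fun V => ?_⟩⟩
  · have hZ := hZg.comm
    set M := (List.ofFn fun i => Z - OrePoly.C (Z.upsilon (c i))).prod with hM
    have hpos : 0 < Module.finrank δ.constants K := Module.finrank_pos
    obtain ⟨hMm, hMdeg, hMcen⟩ := list_prod_monic_central (r := Module.finrank δ.constants K)
      (List.ofFn fun i => Z - OrePoly.C (Z.upsilon (c i))) (by
        intro N hN
        obtain ⟨i, rfl⟩ := List.mem_ofFn.mp hN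
        have hd := hZg.natDegree_eq (hc i)
        exact ⟨hZg.1.sub_C (hd ▸ hpos) _, (natDegree_sub_C _ _).trans hd,
          sub_upsilon_comm hZ (hc i)⟩)
    rw [← hM, List.length_ofFn] at hMdeg
    rw [← hM] at hMm hMcen
    have hMev : ∀ i, ev (c i) M = 0 := fun i => by
      rw [hM, ← evAlgHom_apply, map_list_prod]
      refine List.prod_eq_zero (List.mem_map.mpr ⟨_, List.mem_ofFn.mpr ⟨i, rfl⟩, ?_⟩)
      exact ev_sub_upsilon hZ (c i)
    obtain ⟨G, hG, hGdeg, hGker⟩ := exists_annihilator hZ hc hυ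
      fun i => LinearMap.ker (OrePoly.ev (c i) P)
    obtain ⟨S, hS⟩ := (hGker P).mp fun i x hx => hx
    have hS0 : S ≠ 0 := by rintro rfl; exact hP (by rw [hS, zero_mul])
    have hdeg : P.natDegree = S.natDegree + G.natDegree := by
      conv_lhs => rw [hS]
      exact natDegree_mul hS0 hG.ne_zero
    rw [← hGdeg]
    refine ⟨by omega, fun heq => ?_, ?_⟩
    -- Equality of degrees makes S a nonzero constant, so P generates the same left ideal as G, and
    -- this ideal contains M.
    · have hSC := eq_C_of_natDegree_eq_zero (P := S) (by omega)
      set s := S.toPoly.coeff 0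
      have hs : s ≠ 0 := by
        intro h
        rw [h, map_zero] at hSC
        exact hS0 hSC
      obtain ⟨T, hT⟩ := (hGker M).mp fun i x _ => by rw [hMev, LinearMap.zero_apply]
      have hGP : G = C s⁻¹ * P := by
        rw [hS, hSC, ← mul_assoc, ← map_mul, inv_mul_cancel₀ hs, map_one, one_mul]
      rw [hGP, ← mul_assoc] at hT
      have h := hMcen P
      rw [hT, ← mul_assoc] at h
      -- `∣` asks for a cofactor on the right of P; centrality of M and cancellation of P move it
      -- there.
      exact ⟨T * C s⁻¹, hT.trans (mul_right_cancel₀ hP h)⟩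
    · rintro ⟨Q, hQ⟩
      have hQP : M = Q * P := by
        have h := hMcen P
        nth_rewrite 1 [hQ] at h
        rw [mul_assoc] at h
        exact (mul_left_cancel₀ hP h).symm
      -- G vanishes on the kernel of each `ev (c i) P`, so its evaluations factor through those of
      -- P; T lifts the factors t i.
      have hcomp : ∀ i, ∃ t : Module.End δ.constants K, t ∘ₗ ev (c i) P = ev (c i) G := fun i =>
        LinearMap.exists_comp_eq_of_ker_le _ _ ((hGker G).mpr ⟨1, (one_mul G).symm⟩ i)
      choose t ht using hcomp
      obtain ⟨T, hT⟩ := exists_forall_ev_eq hZ hc hυ t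
      obtain ⟨G', hG', hGdeg', hGker'⟩ := exists_annihilator hZ hc hυ fun _ => ⊤
      -- Both are monic of degree m r, and M lies in the left ideal generated by G'.
      have hMG' : M = G' := by
        obtain ⟨R, hR⟩ := (hGker' M).mp fun i x _ => by rw [hMev, LinearMap.zero_apply]
        exact hMm.eq_of_eq_mul hG' (by rw [hMdeg, hGdeg']; simp) hR
      obtain ⟨R, hR⟩ := (hGker' (G - T * P)).mp fun i x _ => by
        rw [ev_sub, ev_mul, hT, ← ht]
        exact sub_self _
      rw [← hMG', hQP, ← mul_assoc, sub_eq_iff_eq_add, ← add_mul] at hR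
      -- Here G = (R Q + T) P, so deg P ≤ deg G; with P = S G the degrees agree.
      have hRQ : R * Q + T ≠ 0 := fun h => hG.ne_zero (by rw [hR, h, zero_mul])
      have h := natDegree_mul hRQ hP
      rw [← hR] at h
      omega
  · obtain ⟨G, hG, hGdeg, hGker⟩ := exists_annihilator hZg.comm hc hυ V
    refine ⟨G, ⟨hG, hGdeg, (hGker G).mpr ⟨1, (one_mul G).symm⟩⟩, ?_⟩
    rintro P ⟨hP, hPdeg, hPV⟩
    obtain ⟨S, hS⟩ := (hGker P).mp hPV
    exact hP.eq_of_eq_mul hG (hPdeg.trans hGdeg.symm) hS
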